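/- Let $R$ be a commutative ring and let $(\mathscr{C},\mathbb{E},\mathfrak{s})$ be a small $R$-linear extriangulated category (in the sense of Nakaoka--Palu). A morphism $f$ of $\mathscr{C}$ is called projective if $\mathbb{E}(f,-)=0$, and injective if $\mathbb{E}(-,f)=0$. A projective deflation is a deflation that is a projective morphism, and an injective inflation is an inflation that is an injective morphism. An object $P$ is projective if every morphism from $P$ to $X$ lifts along every deflation $B\to X$; injective objects are defined dually. The category has enough projective morphisms (resp. enough projective objects) if every object $X$ admits a projective deflation $G\to X$ (resp. a deflation $P\to X$ with $P$ a projective object); enough injective morphisms and enough injective objects are defined dually. Put $\mathbb{E}^0=\mathrm{Hom}_{\mathscr{C}}$, $\mathbb{E}^1=\mathbb{E}$ and $$\mathbb{E}^{n+1}(X,Y)=\int^{M\in\mathscr{C}}\mathbb{E}^n(M,Y)\otimes_R\mathbb{E}(X,M)\qquad(n\ge 1),$$ and for $n\ge 0$ define the bifunctors $\mathbb{E}_I^{-n},\mathbb{E}_{II}^{-n}\colon\mathscr{C}^{\mathrm{op}}\times\mathscr{C}\to\mathrm{Mod}\,R$, with the evident functoriality, as modules of natural transformations: $$\mathbb{E}_I^{-n}(X,A)=\mathrm{Nat}\big(\mathbb{E}^n(A,-),\mathscr{C}(X,-)\big),\qquad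 \mathbb{E}_{II}^{-n}(X,A)=\mathrm{Nat}\big(\mathbb{E}^n(-,X),\mathscr{C}(-,A)\big).$$ (a) Assume that $(\mathscr{C},\mathbb{E},\mathfrak{s})$ has enough projective morphisms and enough injective objects. Then the following are equivalent. 1. $\mathbb{E}_I^{-1}(I,-)=0$ for every injective object $I$. 2. $\mathbb{E}_I^{-n}(I,-)=0$ for every injective object $I$ and every $n>0$. 3. $\mathbb{E}_I^{-n}(i,-)=0$ for every injective inflation $i$ and every $n>0$. 4. $\mathscr{C}(I,x)\colon\mathscr{C}(I,A)\to\mathscr{C}(I,B)$ is injective for every injective object $I$ and every inflation $x\colon A\to B$. (b) Dually, assume that $(\mathscr{C},\mathbb{E},\mathfrak{s})$ has enough injective morphisms and enough projective objects. Then the following are equivalent. 1. $\mathbb{E}_{II}^{-1}(-,P)=0$ for every projective object $P$. 2. $\mathbb{E}_{II}^{-n}(-,P)=0$ for every projective object $P$ and every $n>0$. 3. $\mathbb{E}_{II}^{-n}(-,p)=0$ for every projective deflation $p$ and every $n>0$. 4. $\mathscr{C}(y,P)\colon\mathscr{C}(C,P)\to\mathscr{C}(B,P)$ is injective for every projective object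 $P$ and every deflation $y\colon B\to C$. -/

import Mathlib

open CategoryTheory CategoryTheory.Limits Opposite

universe u

namespace Extri

noncomputable section

section Bimodules

variable (R : Type u) [CommRing R] (C : Type u) [SmallCategory C]

/-- Bifunctors `Cᵒᵖ × C → Mod R`, written in curried form. -/
abbrev Bifunctor := Cᵒᵖ ⥤ C ⥤ ModuleCat.{u} R

variable {R C}

/-- `R`-bilinearity of a bifunctor: it is additive and `R`-linear on morphisms, in each variable. -/
structure IsBilinear [Preadditive C] [Linear R C] (F : Bifunctor R C) : Prop where
  map_add_right : ∀ (X : C) {Y Y' : C} (f g : Y ⟶ Y'),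
    (F.obj (op X)).map (f + g) = (F.obj (op X)).map f + (F.obj (op X)).map g
  map_smul_right : ∀ (X : C) {Y Y' : C} (r : R) (f : Y ⟶ Y'),
    (F.obj (op X)).map (r • f) = r • (F.obj (op X)).map f
  map_add_left : ∀ {X X' : C} (f g : X ⟶ X'), F.map (f + g).op = F.map f.op + F.map g.op
  map_smul_left : ∀ {X X' : C} (r : R) (f : X ⟶ X'), F.map (r • f).op = r • F.map f.op

/-- Composition of bimodules:
`(G ◇ F)(X, Y)` is the coend over `M : C` of `G(M, Y) ⊗[R] F(X, M)`. -/
def diamond (G F : Bifunctor R C) : Bifunctor R C :=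
  F ⋙ (G.flip ⋙
      MonoidalCategory.externalProductBifunctorCurried Cᵒᵖ C (ModuleCat.{u} R)).flip ⋙
    (Functor.whiskeringRight _ _ _).obj (coendFunctor C (ModuleCat.{u} R))

end Bimodules

section Extensions

variable {R : Type u} [CommRing R] {C : Type u} [SmallCategory C]

/-- The `R`-module `E(X, A)` of `E`-extensions. -/
abbrev Ext (E : Bifunctor R C) (X A : C) : Type u := (E.obj (op X)).obj A

/-- The extension `a_* δ = E(X, a)(δ)`. -/
def push (E : Bifunctor R C) {X A A' : C} (a : A ⟶ A') (δ : Ext E X A) : Ext E X A' :=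
  ((E.obj (op X)).map a).hom δ

/-- The extension `c^* δ = E(c, A)(δ)`. -/
def pull (E : Bifunctor R C) {X X' A : C} (c : X' ⟶ X) (δ : Ext E X A) : Ext E X' A :=
  ((E.map c.op).app A).hom δ

/-- `(a, c)` is a morphism of extensions from `δ` to `δ'`, that is `a_* δ = c^* δ'`. -/
def IsExtHom (E : Bifunctor R C) {X A X' A' : C} (δ : Ext E X A) (δ' : Ext E X' A')
    (a : A ⟶ A') (c : X ⟶ X') : Prop :=
  push E a δ = pull E c δ'

/-- Sequences `A ⟶ B ⟶ X` with fixed end terms. -/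
structure Seq (A X : C) where
  /-- the middle term -/
  mid : C
  /-- the first morphism -/
  fst : A ⟶ mid
  /-- the second morphism -/
  snd : mid ⟶ X

/-- Two sequences with the same end terms are equivalent if there is an isomorphism between the
middle terms that is compatible with the morphisms. -/
instance seqSetoid (A X : C) : Setoid (Seq A X) where
  r S T := ∃ b : S.mid ≅ T.mid, S.fst ≫ b.hom = T.fst ∧ b.hom ≫ T.snd = S.snd
  iseqv :=
    { refl := fun S => ⟨Iso.refl _, by simp, by simp⟩
      symm := by
        rintro S T ⟨b, h₁, h₂⟩
        exact ⟨b.symm, by simp [← h₁], by simp [← h₂]⟩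
      trans := by
        rintro S T U ⟨b, h₁, h₂⟩ ⟨c, h₃, h₄⟩
        exact ⟨b ≪≫ c, by simp [reassoc_of% h₁, h₃], by simp [h₄, h₂]⟩ }

/-- Equivalence classes of sequences `A ⟶ B ⟶ X`. -/
abbrev SeqClass (A X : C) : Type u := Quotient (seqSetoid A X)

/-- The equivalence class `[A ⟶ B ⟶ X]`. -/
def seqClass {A B X : C} (x : A ⟶ B) (y : B ⟶ X) : SeqClass A X :=
  Quotient.mk (seqSetoid A X) ⟨B, x, y⟩

/-- The direct sum `δ ⊕ δ'` in `E(X ⊞ X', A ⊞ A')`, with components `(δ, 0, 0, δ')`. -/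
def extSum (E : Bifunctor R C) [Preadditive C] [HasBinaryBiproducts C]
    {X A X' A' : C} (δ : Ext E X A) (δ' : Ext E X' A') : Ext E (X ⊞ X') (A ⊞ A') :=
  pull E biprod.fst (push E biprod.inl δ) + pull E biprod.snd (push E biprod.inr δ')

end Extensions

attribute [local instance] hasBinaryBiproducts_of_finite_biproducts

/-- An `R`-linear extriangulated structure on an additive `R`-linear category `C`. -/
structure ExtriangulatedStructure (R : Type u) [CommRing R] (C : Type u) [SmallCategory C]
    [Preadditive C] [Linear R C] [HasFiniteBiproducts C] where
  /-- the bifunctor of extensions -/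
  E : Bifunctor R C
  /-- (ET1) -/
  bilinear : IsBilinear E
  /-- the realization: an equivalence class of sequences for each extension -/
  s : ∀ {X A : C}, Ext E X A → SeqClass A X
  /-- the condition on a realization: a morphism of extensions lifts to the realizing sequences -/
  realize_hom : ∀ {A B X A' B' X' : C} (δ : Ext E X A) (δ' : Ext E X' A')
    (x : A ⟶ B) (y : B ⟶ X) (x' : A' ⟶ B') (y' : B' ⟶ X'),
    s δ = seqClass x y → s δ' = seqClass x' y' →
    ∀ (a : A ⟶ A') (c : X ⟶ X'), IsExtHom E δ δ' a c →
      ∃ b : B ⟶ B', x ≫ b = a ≫ x' ∧ b ≫ y' = y ≫ c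
  /-- (ET2), additivity of the realization: the split extension -/
  realize_zero : ∀ (X A : C),
    s (0 : Ext E X A) = seqClass (biprod.inl : A ⟶ A ⊞ X) (biprod.snd : A ⊞ X ⟶ X)
  /-- (ET2), additivity of the realization: direct sums -/
  realize_sum : ∀ {A B X A' B' X' : C} (δ : Ext E X A) (δ' : Ext E X' A')
    (x : A ⟶ B) (y : B ⟶ X) (x' : A' ⟶ B') (y' : B' ⟶ X'),
    s δ = seqClass x y → s δ' = seqClass x' y' →
      s (extSum E δ δ') = seqClass (biprod.map x x') (biprod.map y y')
  /-- (ET3) -/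
  et3 : ∀ {A B X A' B' X' : C} (δ : Ext E X A) (δ' : Ext E X' A')
    (x : A ⟶ B) (y : B ⟶ X) (x' : A' ⟶ B') (y' : B' ⟶ X'),
    s δ = seqClass x y → s δ' = seqClass x' y' →
    ∀ (a : A ⟶ A') (b : B ⟶ B'), x ≫ b = a ≫ x' →
      ∃ c : X ⟶ X', IsExtHom E δ δ' a c ∧ y ≫ c = b ≫ y'
  /-- (ET3)ᵒᵖ -/
  et3_op : ∀ {A B X A' B' X' : C} (δ : Ext E X A) (δ' : Ext E X' A')
    (x : A ⟶ B) (y : B ⟶ X) (x' : A' ⟶ B') (y' : B' ⟶ X'),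
    s δ = seqClass x y → s δ' = seqClass x' y' →
    ∀ (b : B ⟶ B') (c : X ⟶ X'), y ≫ c = b ≫ y' →
      ∃ a : A ⟶ A', IsExtHom E δ δ' a c ∧ x ≫ b = a ≫ x'
  /-- (ET4) -/
  et4 : ∀ {A B X D F : C} (δ : Ext E D A) (δ' : Ext E F B)
    (f : A ⟶ B) (f' : B ⟶ D) (g : B ⟶ X) (g' : X ⟶ F),
    s δ = seqClass f f' → s δ' = seqClass g g' →
      ∃ (M : C) (d : D ⟶ M) (e : M ⟶ F) (h' : X ⟶ M) (δ'' : Ext E M A),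
        f' ≫ d = g ≫ h' ∧ h' ≫ e = g' ∧
        s δ'' = seqClass (f ≫ g) h' ∧
        s (push E f' δ') = seqClass d e ∧
        pull E d δ'' = δ ∧
        push E f δ'' = pull E e δ'
  /-- (ET4)ᵒᵖ -/
  et4_op : ∀ {A B X D F : C} (δ : Ext E A D) (δ' : Ext E B F)
    (f' : D ⟶ B) (f : B ⟶ A) (g' : F ⟶ X) (g : X ⟶ B),
    s δ = seqClass f' f → s δ' = seqClass g' g →
      ∃ (M : C) (d : M ⟶ D) (e : F ⟶ M) (h' : M ⟶ X) (δ'' : Ext E A M),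
        d ≫ f' = h' ≫ g ∧ e ≫ h' = g' ∧
        s δ'' = seqClass h' (g ≫ f) ∧
        s (pull E f' δ') = seqClass e d ∧
        push E d δ'' = δ ∧
        pull E f δ'' = push E e δ'

namespace ExtriangulatedStructure

variable {R : Type u} [CommRing R] {C : Type u} [SmallCategory C]
    [Preadditive C] [Linear R C] [HasFiniteBiproducts C] (S : ExtriangulatedStructure R C)

/-- `x` is an inflation. -/
def IsInflation {A B : C} (x : A ⟶ B) : Prop :=
  ∃ (X : C) (y : B ⟶ X) (δ : Ext S.E X A), S.s δ = seqClass x y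

/-- `y` is a deflation. -/
def IsDeflation {B X : C} (y : B ⟶ X) : Prop :=
  ∃ (A : C) (x : A ⟶ B) (δ : Ext S.E X A), S.s δ = seqClass x y

/-- `f` is a projective morphism: `E(f, -) = 0`. -/
def IsProjectiveMor {X Y : C} (f : X ⟶ Y) : Prop := S.E.map f.op = 0

/-- `f` is an injective morphism: `E(-, f) = 0`. -/
def IsInjectiveMor {X Y : C} (f : X ⟶ Y) : Prop := S.E.flip.map f = 0

/-- `P` is a projective object: morphisms from `P` lift along deflations. -/
def IsProjectiveObj (P : C) : Prop :=
  ∀ {B X : C} (y : B ⟶ X), S.IsDeflation y → ∀ c : P ⟶ X, ∃ b : P ⟶ B, b ≫ y = c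

/-- `I` is an injective object: morphisms to `I` extend along inflations. -/
def IsInjectiveObj (I : C) : Prop :=
  ∀ {A B : C} (x : A ⟶ B), S.IsInflation x → ∀ a : A ⟶ I, ∃ b : B ⟶ I, x ≫ b = a

/-- Every object `X` admits a projective deflation `G ⟶ X`. -/
def EnoughProjectiveMors : Prop :=
  ∀ X : C, ∃ (G : C) (g : G ⟶ X), S.IsDeflation g ∧ S.IsProjectiveMor g

/-- Every object `A` admits an injective inflation `A ⟶ G`. -/
def EnoughInjectiveMors : Prop :=
  ∀ A : C, ∃ (G : C) (g : A ⟶ G), S.IsInflation g ∧ S.IsInjectiveMor g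

/-- Every object `X` admits a deflation `P ⟶ X` from a projective object. -/
def EnoughProjectiveObjs : Prop :=
  ∀ X : C, ∃ (P : C) (p : P ⟶ X), S.IsProjectiveObj P ∧ S.IsDeflation p

/-- Every object `A` admits an inflation `A ⟶ I` to an injective object. -/
def EnoughInjectiveObjs : Prop :=
  ∀ A : C, ∃ (I : C) (i : A ⟶ I), S.IsInjectiveObj I ∧ S.IsInflation i

/-- The positive extension bifunctors `Eⁿ`: `E⁰ = Hom`, `E¹ = E` and `Eⁿ⁺¹ = Eⁿ ◇ E`. -/
def posExt : ℕ → Bifunctor R C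
  | 0 => linearCoyoneda R C
  | 1 => S.E
  | n + 2 => diamond (posExt (n + 1)) S.E

/-- The negative extension bifunctor `E_I⁻ⁿ`. Its value at `(X, A)` is the `R`-module of natural
transformations from `Eⁿ(A, -)` to `C(X, -)`. -/
def negExtI (n : ℕ) : Bifunctor R C :=
  linearCoyoneda R C ⋙ linearYoneda R (C ⥤ ModuleCat.{u} R) ⋙
    (Functor.whiskeringLeft _ _ _).obj (S.posExt n).rightOp

/-- The negative extension bifunctor `E_II⁻ⁿ`. Its value at `(X, A)` is the `R`-module of natural
transformations from `Eⁿ(-, X)` to `C(-, A)`. -/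
def negExtII (n : ℕ) : Bifunctor R C :=
  (S.posExt n).flip.op ⋙ linearCoyoneda R (Cᵒᵖ ⥤ ModuleCat.{u} R) ⋙
    (Functor.whiskeringLeft _ _ _).obj (linearYoneda R C)

end ExtriangulatedStructure

end

end Extri

/-! Let `K ⟶ G ⟶ X` realize `δ₀`, with `g : G ⟶ X` a projective deflation. Every extension in `E(X,
Y)` dies on `G`, hence is a pushout `a_* δ₀`. A natural transformation `E(X, -) ⟶ C(I, -)` is
therefore determined by the image of `δ₀`, which can be any `k : I ⟶ K` killed by `K ⟶ G`. So degree
-1 vanishes at `I` iff `C(I, -)` is injective on these particular inflations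
(`natTrans_eq_zero_iff_of_projective_deflation`). The main step,
`eq_zero_of_comp_inflation_eq_zero`, passes to an arbitrary inflation `A ⟶ B` with cone `X` by
realizing `(δ₀, δ)` in `E(X, K ⊞ A)` and applying (ET4) to both summands. This gives 1 ↔ 4. Higher
degrees reduce to degree -1 because a map out of a coend is tested on pure tensors. Finally,
injective morphisms factor through injective objects, whose identities are injective inflations;
this compares objects with inflations one degree at a time. Part (b) is dual. -/

namespace Extri

noncomputable section

/-! ### Natural transformations out of a coend. -/

section Diamond

variable {R : Type u} [CommRing R] {C : Type u} [SmallCategory C]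

/-- The coprojection `G(M, Y) ⊗ F(X, M) ⟶ (G ◇ F)(X, Y)`. -/
def diamondMk (G F : Bifunctor R C) (X M Y : C) :
    MonoidalCategory.tensorObj ((G.obj (op M)).obj Y) ((F.obj (op X)).obj M) ⟶
      ((diamond G F).obj (op X)).obj Y :=
  coend.ι ((((G.flip ⋙ MonoidalCategory.externalProductBifunctorCurried Cᵒᵖ C
    (ModuleCat.{u} R)).flip.obj (F.obj (op X))).obj Y)) M

lemma diamondMk_map_right (G F : Bifunctor R C) (X M : C) {Y Y' : C} (f : Y ⟶ Y') :
    diamondMk G F X M Y ≫ ((diamond G F).obj (op X)).map f =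
      MonoidalCategory.whiskerRight ((G.obj (op M)).map f) _ ≫ diamondMk G F X M Y' :=
  (coend.ι_map _ _).trans rfl

lemma diamondMk_map_left (G F : Bifunctor R C) {X X' : C} (M Y : C) (f : X' ⟶ X) :
    diamondMk G F X M Y ≫ ((diamond G F).map f.op).app Y =
      MonoidalCategory.whiskerLeft _ ((F.map f.op).app M) ≫ diamondMk G F X' M Y :=
  (coend.ι_map _ _).trans rfl

lemma diamond_hom_ext {G F : Bifunctor R C} {X Y : C} {Z : ModuleCat.{u} R}
    {f g : ((diamond G F).obj (op X)).obj Y ⟶ Z}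
    (h : ∀ M, diamondMk G F X M Y ≫ f = diamondMk G F X M Y ≫ g) : f = g :=
  coend.hom_ext h

/-- The natural transformation `ξ ↦ ξ ⊗ δ` from `G(M, -)` to `(G ◇ F)(X, -)`. -/
def diamondTensorRight (G F : Bifunctor R C) {X M : C} (δ : Ext F X M) :
    G.obj (op M) ⟶ (diamond G F).obj (op X) where
  app Y := ModuleCat.ofHom ((TensorProduct.mk R (Ext G M Y) (Ext F X M)).flip δ) ≫
    diamondMk G F X M Y
  naturality Y Y' f := by
    rw [Category.assoc, diamondMk_map_right]
    rfl

/-- The natural transformation `δ ↦ ξ ⊗ δ` from `F(-, M)` to `(G ◇ F)(-, Y)`. -/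
def diamondTensorLeft (G F : Bifunctor R C) {M Y : C} (ξ : Ext G M Y) :
    F.flip.obj M ⟶ (diamond G F).flip.obj Y where
  app X := ModuleCat.ofHom (TensorProduct.mk R (Ext G M Y) (Ext F X.unop M) ξ) ≫
    diamondMk G F X.unop M Y
  naturality X X' f := by
    rw [Category.assoc]
    erw [diamondMk_map_left G F M Y f.unop]
    rfl

lemma diamond_hom_eq_zero {G F : Bifunctor R C} {X Y : C} {Z : ModuleCat.{u} R}
    {f : ((diamond G F).obj (op X)).obj Y ⟶ Z}
    (h : ∀ (M : C) (ξ : Ext G M Y) (δ : Ext F X M),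
      f.hom ((diamondMk G F X M Y).hom (TensorProduct.tmul R ξ δ)) = 0) : f = 0 := by
  refine diamond_hom_ext fun M => ?_
  rw [comp_zero]
  refine ModuleCat.hom_ext (TensorProduct.ext' fun ξ δ => ?_)
  exact h M ξ δ

/-- Fixing the right tensor factor `δ` restricts `α` to a transformation out of `G(M, -)`, and these
restrictions determine `α`. -/
lemma diamond_natTrans_right_eq_zero {G F : Bifunctor R C} {X : C} {H : C ⥤ ModuleCat.{u} R}
    (hG : ∀ (M : C) (β : G.obj (op M) ⟶ H), β = 0)
    (α : (diamond G F).obj (op X) ⟶ H) : α = 0 := by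
  ext Y : 2
  refine diamond_hom_eq_zero fun M ξ δ => ?_
  exact congr((NatTrans.app $(hG M (diamondTensorRight G F δ ≫ α)) Y).hom ξ)

lemma diamond_natTrans_left_eq_zero {G F : Bifunctor R C} {Y : C} {H : Cᵒᵖ ⥤ ModuleCat.{u} R}
    (hF : ∀ (M : C) (β : F.flip.obj M ⟶ H), β = 0)
    (α : (diamond G F).flip.obj Y ⟶ H) : α = 0 := by
  ext X : 2
  refine diamond_hom_eq_zero (X := X.unop) fun M ξ δ => ?_
  exact congr((NatTrans.app $(hF M (diamondTensorLeft G F ξ ≫ α)) X).hom δ)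

end Diamond

attribute [local instance] hasBinaryBiproducts_of_finite_biproducts

/-! ### From degree -1 to all negative degrees. -/

namespace ExtriangulatedStructure

variable {R : Type u} [CommRing R] {C : Type u} [SmallCategory C]
    [Preadditive C] [Linear R C] [HasFiniteBiproducts C] (S : ExtriangulatedStructure R C)

lemma isZero_negExtI_obj_iff (n : ℕ) (X : C) :
    IsZero ((S.negExtI n).obj (op X)) ↔
      ∀ (A : C) (α : (S.posExt n).obj (op A) ⟶ (linearCoyoneda R C).obj (op X)), α = 0 := by
  rw [Functor.isZero_iff]
  refine forall_congr' fun A => ?_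
  constructor
  · intro h
    have := ModuleCat.subsingleton_of_isZero h
    exact fun α => this.elim α 0
  · intro h
    exact @ModuleCat.isZero_of_subsingleton R _ _ ⟨fun α β => (h α).trans (h β).symm⟩

lemma isZero_negExtII_flip_obj_iff (n : ℕ) (A : C) :
    IsZero ((S.negExtII n).flip.obj A) ↔
      ∀ (X : C) (α : (S.posExt n).flip.obj X ⟶ (linearYoneda R C).obj A), α = 0 := by
  rw [Functor.isZero_iff]
  constructor
  · intro h X
    have := ModuleCat.subsingleton_of_isZero (h (op X))
    exact fun α => this.elim α 0
  · intro h X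
    exact @ModuleCat.isZero_of_subsingleton R _ _
      ⟨fun α β => (h X.unop α).trans (h X.unop β).symm⟩

lemma isZero_negExtI_of_one {X : C} (h : IsZero ((S.negExtI 1).obj (op X))) :
    ∀ n : ℕ, 0 < n → IsZero ((S.negExtI n).obj (op X))
  | 1, _ => h
  | n + 2, _ => by
    have ih := isZero_negExtI_of_one h (n + 1) n.succ_pos
    rw [isZero_negExtI_obj_iff] at ih ⊢
    exact fun A α => diamond_natTrans_right_eq_zero ih α

/-- No induction is needed here, unlike for type I: in `Eⁿ ◇ E` the first variable sits in the
factor `E`, so the degree -1 hypothesis applies directly. -/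
lemma isZero_negExtII_of_one {A : C} (h : IsZero ((S.negExtII 1).flip.obj A)) :
    ∀ n : ℕ, 0 < n → IsZero ((S.negExtII n).flip.obj A)
  | 1, _ => h
  | n + 2, _ => by
    rw [isZero_negExtII_flip_obj_iff] at h ⊢
    exact fun A α => diamond_natTrans_left_eq_zero h α

end ExtriangulatedStructure

/-! ### Elementary calculus of extensions. -/

section Extensions

variable {R : Type u} [CommRing R] {C : Type u} [SmallCategory C] (E : Bifunctor R C)

@[simp]
lemma push_id {X A : C} (δ : Ext E X A) : push E (𝟙 A) δ = δ := by
  simp [push]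

@[simp]
lemma push_comp {X A A' A'' : C} (a : A ⟶ A') (a' : A' ⟶ A'') (δ : Ext E X A) :
    push E (a ≫ a') δ = push E a' (push E a δ) := by
  simp [push]

@[simp]
lemma push_zero {X A A' : C} (a : A ⟶ A') : push E a (0 : Ext E X A) = 0 :=
  map_zero _

@[simp]
lemma push_add {X A A' : C} (a : A ⟶ A') (δ δ' : Ext E X A) :
    push E a (δ + δ') = push E a δ + push E a δ' :=
  map_add _ _ _

@[simp]
lemma pull_id {X A : C} (δ : Ext E X A) : pull E (𝟙 X) δ = δ := by
  simp [pull]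

@[simp]
lemma pull_comp {X X' X'' A : C} (c : X' ⟶ X) (c' : X'' ⟶ X') (δ : Ext E X A) :
    pull E (c' ≫ c) δ = pull E c' (pull E c δ) := by
  simp [pull]

@[simp]
lemma pull_zero {X X' A : C} (c : X' ⟶ X) : pull E c (0 : Ext E X A) = 0 :=
  map_zero _

@[simp]
lemma pull_add {X X' A : C} (c : X' ⟶ X) (δ δ' : Ext E X A) :
    pull E c (δ + δ') = pull E c δ + pull E c δ' :=
  map_add _ _ _

lemma push_pull {X X' A A' : C} (a : A ⟶ A') (c : X' ⟶ X) (δ : Ext E X A) :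
    push E a (pull E c δ) = pull E c (push E a δ) :=
  (congr(($((E.map c.op).naturality a)).hom δ)).symm

lemma exists_iso_of_seqClass_eq {A B B' X : C} {x : A ⟶ B} {y : B ⟶ X} {x' : A ⟶ B'}
    {y' : B' ⟶ X} (h : seqClass x y = seqClass x' y') :
    ∃ b : B ≅ B', x ≫ b.hom = x' ∧ b.hom ≫ y' = y :=
  Quotient.exact h

lemma seqClass_eq_of_iso {A B B' X : C} {x : A ⟶ B} {y : B ⟶ X} {x' : A ⟶ B'}
    {y' : B' ⟶ X} (b : B ≅ B') (h : x ≫ b.hom = x') (h' : b.hom ≫ y' = y) :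
    seqClass x y = seqClass x' y' :=
  Quotient.sound ⟨b, h, h'⟩

end Extensions

section Bilinear

variable {R : Type u} [CommRing R] {C : Type u} [SmallCategory C] [Preadditive C] [Linear R C]
  {E : Bifunctor R C}

namespace IsBilinear

lemma add_push (hE : IsBilinear E) {X A A' : C} (a a' : A ⟶ A') (δ : Ext E X A) :
    push E (a + a') δ = push E a δ + push E a' δ :=
  congr(($(hE.map_add_right X a a')).hom δ)

lemma smul_push (hE : IsBilinear E) {X A A' : C} (r : R) (a : A ⟶ A') (δ : Ext E X A) :
    push E (r • a) δ = r • push E a δ :=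
  congr(($(hE.map_smul_right X r a)).hom δ)

lemma add_pull (hE : IsBilinear E) {X X' A : C} (c c' : X' ⟶ X) (δ : Ext E X A) :
    pull E (c + c') δ = pull E c δ + pull E c' δ :=
  congr((($(hE.map_add_left c c')).app A).hom δ)

lemma smul_pull (hE : IsBilinear E) {X X' A : C} (r : R) (c : X' ⟶ X) (δ : Ext E X A) :
    pull E (r • c) δ = r • pull E c δ :=
  congr((($(hE.map_smul_left r c)).app A).hom δ)

lemma zero_push (hE : IsBilinear E) {X A A' : C} (δ : Ext E X A) :
    push E (0 : A ⟶ A') δ = 0 := by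
  simpa using hE.smul_push 0 (0 : A ⟶ A') δ

lemma zero_pull (hE : IsBilinear E) {X X' A : C} (δ : Ext E X A) :
    pull E (0 : X' ⟶ X) δ = 0 := by
  simpa using hE.smul_pull 0 (0 : X' ⟶ X) δ

lemma sub_push (hE : IsBilinear E) {X A A' : C} (a a' : A ⟶ A') (δ : Ext E X A) :
    push E (a - a') δ = push E a δ - push E a' δ := by
  rw [eq_sub_iff_add_eq, ← hE.add_push, sub_add_cancel]

lemma sub_pull (hE : IsBilinear E) {X X' A : C} (c c' : X' ⟶ X) (δ : Ext E X A) :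
    pull E (c - c') δ = pull E c δ - pull E c' δ := by
  rw [eq_sub_iff_add_eq, ← hE.add_pull, sub_add_cancel]

end IsBilinear

end Bilinear

/-! ### Exactness properties of realizations, and reduction of general inflations and deflations to
special ones. -/

namespace ExtriangulatedStructure

variable {R : Type u} [CommRing R] {C : Type u} [SmallCategory C]
    [Preadditive C] [Linear R C] [HasFiniteBiproducts C] (S : ExtriangulatedStructure R C)

lemma exists_realization {X A : C} (δ : Ext S.E X A) :
    ∃ (B : C) (x : A ⟶ B) (y : B ⟶ X), S.s δ = seqClass x y := by
  obtain ⟨⟨B, x, y⟩, h⟩ := Quotient.exists_rep (S.s δ)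
  exact ⟨B, x, y, h.symm⟩

lemma realize_zero' (X A : C) :
    S.s (0 : Ext S.E X A) = seqClass (biprod.inr : A ⟶ X ⊞ A) (biprod.fst : X ⊞ A ⟶ X) :=
  (S.realize_zero X A).trans (seqClass_eq_of_iso (biprod.braiding A X)
    (by ext <;> simp) (by simp))

section

variable {S} {A B X : C} {x : A ⟶ B} {y : B ⟶ X} {δ : Ext S.E X A}

lemma push_eq_zero (h : S.s δ = seqClass x y) : push S.E x δ = 0 := by
  obtain ⟨c, hc, -⟩ := S.et3 δ (0 : Ext S.E X B) _ _ _ _ h (S.realize_zero X B) x biprod.inl rfl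
  exact hc.trans (pull_zero _ _)

lemma pull_eq_zero (h : S.s δ = seqClass x y) : pull S.E y δ = 0 := by
  obtain ⟨a, ha, -⟩ := S.et3_op (0 : Ext S.E B A) δ _ _ _ _ (S.realize_zero B A) h biprod.snd y rfl
  exact ha.symm.trans (push_zero _ _)

/-- (ET3)ᵒᵖ is applied to a split sequence starting at `W`; its other end term is irrelevant and is
also taken to be `W`. -/
lemma exists_lift_of_comp_eq_zero (h : S.s δ = seqClass x y) {W : C} (f : W ⟶ B)
    (hf : f ≫ y = 0) : ∃ k : W ⟶ A, k ≫ x = f := by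
  obtain ⟨a, -, ha⟩ := S.et3_op (0 : Ext S.E W W) δ _ _ _ _ (S.realize_zero W W) h
    (biprod.desc f 0) 0 (by ext <;> simp [hf])
  exact ⟨a, by simpa using ha.symm⟩

lemma exists_desc_of_comp_eq_zero (h : S.s δ = seqClass x y) {W : C} (f : B ⟶ W)
    (hf : x ≫ f = 0) : ∃ k : X ⟶ W, y ≫ k = f := by
  obtain ⟨c, -, hc⟩ := S.et3 δ (0 : Ext S.E W W) _ _ _ _ h (S.realize_zero W W)
    0 (biprod.lift 0 f) (by ext <;> simp [hf])
  exact ⟨c, by simpa using hc⟩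

lemma exists_desc_of_push_eq_zero (h : S.s δ = seqClass x y) {W : C} (a : A ⟶ W)
    (ha : push S.E a δ = 0) : ∃ r : B ⟶ W, x ≫ r = a := by
  obtain ⟨b, hb, -⟩ := S.realize_hom δ (0 : Ext S.E X W) _ _ _ _ h (S.realize_zero X W) a (𝟙 X)
    (ha.trans (pull_zero _ _).symm)
  exact ⟨b ≫ biprod.fst, by rw [reassoc_of% hb]; simp⟩

lemma exists_lift_of_pull_eq_zero (h : S.s δ = seqClass x y) {W : C} (c : W ⟶ X)
    (hc : pull S.E c δ = 0) : ∃ s : W ⟶ B, s ≫ y = c := by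
  obtain ⟨b, -, hb⟩ := S.realize_hom (0 : Ext S.E W A) δ _ _ _ _ (S.realize_zero W A) h (𝟙 A) c
    ((push_zero _ _).trans hc.symm)
  exact ⟨biprod.inr ≫ b, by rw [Category.assoc, hb]; simp⟩

/-- Since `y^* ε = 0`, `y` lifts through the deflation realizing `ε`; (ET3)ᵒᵖ over the identity of
`X` then supplies the map on first terms. -/
lemma exists_push_eq (h : S.s δ = seqClass x y) {W : C} (ε : Ext S.E X W)
    (hε : pull S.E y ε = 0) : ∃ a : A ⟶ W, push S.E a δ = ε := by
  obtain ⟨B', x', y', h'⟩ := S.exists_realization ε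
  obtain ⟨s, hs⟩ := exists_lift_of_pull_eq_zero h' y hε
  obtain ⟨a, ha, -⟩ := S.et3_op δ ε _ _ _ _ h h' s (𝟙 X) (by simp [hs])
  exact ⟨a, ha.trans (pull_id _ _)⟩

lemma exists_pull_eq (h : S.s δ = seqClass x y) {W : C} (ε : Ext S.E W A)
    (hε : push S.E x ε = 0) : ∃ c : W ⟶ X, pull S.E c δ = ε := by
  obtain ⟨B', x', y', h'⟩ := S.exists_realization ε
  obtain ⟨r, hr⟩ := exists_desc_of_push_eq_zero h' x hε
  obtain ⟨c, hc, -⟩ := S.et3 ε δ _ _ _ _ h' h (𝟙 A) r (by simp [hr])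
  exact ⟨c, hc.symm.trans (push_id _ _)⟩

/-- The middle term `M` of `(δ₀, δ)` plays the role of the pullback of `G` and `B` over `X`: it is
an extension of `B` by `K` and of `G` by `A`. The second extension splits because `g^* δ = 0`. -/
lemma eq_zero_of_comp_inflation_eq_zero {I K G : C} {κ : K ⟶ G} {g : G ⟶ X} {δ₀ : Ext S.E X K}
    (h₀ : S.s δ₀ = seqClass κ g) (h : S.s δ = seqClass x y) (hg : pull S.E g δ = 0)
    (hκ : ∀ k : I ⟶ K, k ≫ κ = 0 → k = 0) (f : I ⟶ A) (hf : f ≫ x = 0) : f = 0 := by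
  let μ : Ext S.E X (K ⊞ A) := push S.E biprod.inl δ₀ + push S.E biprod.inr δ
  have hfst : push S.E biprod.fst μ = δ₀ := by
    simp [μ, ← push_comp, S.bilinear.zero_push]
  have hsnd : push S.E biprod.snd μ = δ := by
    simp [μ, ← push_comp, S.bilinear.zero_push]
  obtain ⟨M, j, p, hμ⟩ := S.exists_realization μ
  obtain ⟨N₁, d₁, e₁, q₁, ε₁, hd₁, -, hε₁, hs₁, -, -⟩ :=
    S.et4 _ μ _ _ _ _ (S.realize_zero A K) hμ
  obtain ⟨N₂, d₂, e₂, q₂, ε₂, hd₂, -, hε₂, hs₂, -, hr₂⟩ :=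
    S.et4 _ μ _ _ _ _ (S.realize_zero' K A) hμ
  rw [hsnd, h] at hs₁
  rw [hfst, h₀] at hs₂
  obtain ⟨b₁, hb₁, -⟩ := exists_iso_of_seqClass_eq hs₁
  obtain ⟨b₂, hb₂, hb₂'⟩ := exists_iso_of_seqClass_eq hs₂.symm
  -- As `f` dies in `B`, its image in `M` comes from `K`; projecting to `G` shows that the resulting
  -- `k` is killed by `κ`.
  obtain ⟨k, hk⟩ := exists_lift_of_comp_eq_zero hε₁ (f ≫ biprod.inr ≫ j) (by
    rw [Category.assoc, Category.assoc, ← hd₁, biprod.inr_snd_assoc, ← hb₁, reassoc_of% hf,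
      zero_comp])
  have hk0 : k = 0 := hκ k <| by
    have h₁ := congr($hk ≫ q₂)
    rw [Category.assoc, Category.assoc, Category.assoc, Category.assoc, ← hd₂,
      biprod.inl_fst_assoc, biprod.inr_fst_assoc, zero_comp, comp_zero] at h₁
    rw [← hb₂, reassoc_of% h₁, zero_comp]
  -- Up to the isomorphism with `G`, `ε₂` is `g^* δ`. Its vanishing gives a retraction `M ⟶ A`,
  -- which recovers `f`.
  have hε₂0 : ε₂ = 0 := by
    have h₁ := congr(push S.E biprod.snd $hr₂)
    rw [push_pull, hsnd, ← push_comp, biprod.inr_snd, push_id, ← hb₂', pull_comp, hg,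
      pull_zero] at h₁
    exact h₁
  obtain ⟨r, hr⟩ := exists_desc_of_push_eq_zero hε₂ (𝟙 A) (by simpa using hε₂0)
  rw [← Category.comp_id f, ← hr, Category.assoc, ← reassoc_of% hk, hk0]
  simp

/-- Dual argument: `M` acts as a pushout of `G` and `B` under `A`, and `g_* δ = 0` provides the
section `X ⟶ M`. -/
lemma eq_zero_of_deflation_comp_eq_zero {P Q G : C} {g : A ⟶ G} {q : G ⟶ Q} {δ₀ : Ext S.E Q A}
    (h₀ : S.s δ₀ = seqClass g q) (h : S.s δ = seqClass x y) (hg : push S.E g δ = 0)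
    (hq : ∀ k : Q ⟶ P, q ≫ k = 0 → k = 0) (f : X ⟶ P) (hf : y ≫ f = 0) : f = 0 := by
  let μ : Ext S.E (Q ⊞ X) A := pull S.E biprod.fst δ₀ + pull S.E biprod.snd δ
  have hinl : pull S.E biprod.inl μ = δ₀ := by
    simp [μ, ← pull_comp, S.bilinear.zero_pull]
  have hinr : pull S.E biprod.inr μ = δ := by
    simp [μ, ← pull_comp, S.bilinear.zero_pull]
  obtain ⟨M, j, p, hμ⟩ := S.exists_realization μ
  obtain ⟨N₁, d₁, e₁, q₁, ε₁, hd₁, -, hε₁, hs₁, -, -⟩ :=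
    S.et4_op _ μ _ _ _ _ (S.realize_zero' Q X) hμ
  obtain ⟨N₂, d₂, e₂, q₂, ε₂, hd₂, -, hε₂, hs₂, -, hr₂⟩ :=
    S.et4_op _ μ _ _ _ _ (S.realize_zero X Q) hμ
  rw [hinr, h] at hs₁
  rw [hinl, h₀] at hs₂
  obtain ⟨b₁, -, hb₁⟩ := exists_iso_of_seqClass_eq hs₁.symm
  obtain ⟨b₂, hb₂', hb₂⟩ := exists_iso_of_seqClass_eq hs₂
  obtain ⟨k, hk⟩ := exists_desc_of_comp_eq_zero hε₁ (p ≫ biprod.snd ≫ f) (by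
    rw [← reassoc_of% hd₁, biprod.inr_snd_assoc, ← hb₁, Category.assoc, hf, comp_zero])
  have hk0 : k = 0 := hq k <| by
    have h₁ := congr(q₂ ≫ $hk)
    rw [Category.assoc, ← reassoc_of% hd₂, ← reassoc_of% hd₂,
      biprod.inl_fst_assoc, biprod.inl_snd_assoc, zero_comp, comp_zero] at h₁
    rw [← hb₂, Category.assoc, h₁, comp_zero]
  have hε₂0 : ε₂ = 0 := by
    have h₁ := congr(pull S.E biprod.inr $hr₂)
    rw [← push_pull, hinr, ← pull_comp, biprod.inr_snd, pull_id, ← hb₂', push_comp, hg,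
      push_zero] at h₁
    exact h₁
  obtain ⟨r, hr⟩ := exists_lift_of_pull_eq_zero hε₂ (𝟙 X) (by simpa using hε₂0)
  rw [← Category.id_comp f, ← hr, Category.assoc, Category.assoc, ← hk, hk0]
  simp

end

end ExtriangulatedStructure

/-! ### Projective and injective morphisms and objects. -/

namespace ExtriangulatedStructure

variable {R : Type u} [CommRing R] {C : Type u} [SmallCategory C]
    [Preadditive C] [Linear R C] [HasFiniteBiproducts C] {S : ExtriangulatedStructure R C}

lemma IsProjectiveMor.pull_eq_zero {X Y : C} {f : X ⟶ Y} (hf : S.IsProjectiveMor f) {A : C}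
    (δ : Ext S.E Y A) : pull S.E f δ = 0 :=
  congr((NatTrans.app $hf A).hom δ)

lemma IsInjectiveMor.push_eq_zero {A B : C} {f : A ⟶ B} (hf : S.IsInjectiveMor f) {X : C}
    (δ : Ext S.E X A) : push S.E f δ = 0 :=
  congr((NatTrans.app $hf (op X)).hom δ)

lemma isProjectiveMor_of_pull_eq_zero {X Y : C} {f : X ⟶ Y}
    (hf : ∀ (A : C) (δ : Ext S.E Y A), pull S.E f δ = 0) : S.IsProjectiveMor f := by
  refine NatTrans.ext (funext fun A => ModuleCat.hom_ext (LinearMap.ext fun δ => hf A δ))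

lemma isInjectiveMor_of_push_eq_zero {A B : C} {f : A ⟶ B}
    (hf : ∀ (X : C) (δ : Ext S.E X A), push S.E f δ = 0) : S.IsInjectiveMor f := by
  refine NatTrans.ext (funext fun X => ModuleCat.hom_ext (LinearMap.ext fun δ => hf X.unop δ))

lemma IsInjectiveObj.ext_eq_zero {I X : C} (hI : S.IsInjectiveObj I) (δ : Ext S.E X I) :
    δ = 0 := by
  obtain ⟨B, x, y, h⟩ := S.exists_realization δ
  obtain ⟨r, hr⟩ := hI x ⟨X, y, δ, h⟩ (𝟙 I)
  rw [← push_id S.E δ, ← hr, push_comp, push_eq_zero h, push_zero]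

lemma IsProjectiveObj.ext_eq_zero {P A : C} (hP : S.IsProjectiveObj P) (δ : Ext S.E P A) :
    δ = 0 := by
  obtain ⟨B, x, y, h⟩ := S.exists_realization δ
  obtain ⟨r, hr⟩ := hP y ⟨A, x, δ, h⟩ (𝟙 P)
  rw [← pull_id S.E δ, ← hr, pull_comp, pull_eq_zero h, pull_zero]

open ZeroObject in
lemma isInflation_id (S : ExtriangulatedStructure R C) (A : C) : S.IsInflation (𝟙 A) := by
  have : HasZeroObject C := hasZeroObject_of_hasFiniteBiproducts C
  refine ⟨0, 0, 0, (S.realize_zero 0 A).trans (seqClass_eq_of_iso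
    ⟨biprod.fst, biprod.inl, ?_, by simp⟩ (by simp) ?_)⟩
  · ext
    simp
  · exact (isZero_zero C).eq_of_tgt _ _

open ZeroObject in
lemma isDeflation_id (S : ExtriangulatedStructure R C) (X : C) : S.IsDeflation (𝟙 X) := by
  have : HasZeroObject C := hasZeroObject_of_hasFiniteBiproducts C
  refine ⟨0, 0, 0, (S.realize_zero X 0).trans (seqClass_eq_of_iso
    ⟨biprod.snd, biprod.inr, ?_, by simp⟩ ?_ (by simp))⟩
  · ext
    simp
  · exact (isZero_zero C).eq_of_src _ _

section

variable {A B X : C} {x : A ⟶ B} {y : B ⟶ X} {δ : Ext S.E X A}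

/-- The difference `a - a'` factors through `x`, which `k` kills. This makes `a_* δ ↦ k ≫ a`
independent of the choice of `a`, and hence linear and natural. -/
lemma comp_eq_of_push_eq (h : S.s δ = seqClass x y) {I : C} {k : I ⟶ A} (hk : k ≫ x = 0) {Y : C}
    {a a' : A ⟶ Y} (ha : push S.E a δ = push S.E a' δ) : k ≫ a = k ≫ a' := by
  obtain ⟨r, hr⟩ := exists_desc_of_push_eq_zero h (a - a') (by
    rw [S.bilinear.sub_push, ha, sub_self])
  rw [← sub_eq_zero, ← Preadditive.comp_sub, ← hr, reassoc_of% hk, zero_comp]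

lemma comp_eq_of_pull_eq (h : S.s δ = seqClass x y) {P : C} {k : X ⟶ P} (hk : y ≫ k = 0) {W : C}
    {c c' : W ⟶ X} (hc : pull S.E c δ = pull S.E c' δ) : c ≫ k = c' ≫ k := by
  obtain ⟨r, hr⟩ := exists_lift_of_pull_eq_zero h (c - c') (by
    rw [S.bilinear.sub_pull, hc, sub_self])
  rw [← sub_eq_zero, ← Preadditive.sub_comp, ← hr, Category.assoc, hk, comp_zero]

/-- The natural transformation `a_* δ ↦ k ≫ a` from `E(X, -)` to `C(I, -)`, for a projective
deflation `y` and a morphism `k` that vanishes after composition with `x`. -/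
def natTransOfProjectiveDeflation (h : S.s δ = seqClass x y) (hy : S.IsProjectiveMor y) {I : C}
    (k : I ⟶ A) (hk : k ≫ x = 0) : S.E.obj (op X) ⟶ (linearCoyoneda R C).obj (op I) :=
  have spec {Y : C} (ε : Ext S.E X Y) := (exists_push_eq h ε (hy.pull_eq_zero ε)).choose_spec
  { app := fun Y => ModuleCat.ofHom (Y := I ⟶ Y)
      { toFun := fun ε => k ≫ (exists_push_eq h ε (hy.pull_eq_zero ε)).choose
        map_add' := fun ε ε' => by
          rw [← Preadditive.comp_add]
          exact comp_eq_of_push_eq h hk (by rw [S.bilinear.add_push, spec, spec, spec])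
        map_smul' := fun r ε => by
          rw [RingHom.id_apply, ← Linear.comp_smul]
          exact comp_eq_of_push_eq h hk (by rw [S.bilinear.smul_push, spec, spec]) }
    naturality := fun Y Y' f => by
      refine ModuleCat.hom_ext (LinearMap.ext fun ε => ?_)
      refine Eq.trans ?_ (Category.assoc _ _ _).symm
      exact comp_eq_of_push_eq h hk (by rw [push_comp, spec, spec]; rfl) }

/-- The natural transformation `c^* δ ↦ c ≫ k` from `E(-, A)` to `C(-, P)`, for an injective
inflation `x` and a morphism `k` that vanishes after composition with `y`. -/
def natTransOfInjectiveInflation (h : S.s δ = seqClass x y) (hx : S.IsInjectiveMor x) {P : C}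
    (k : X ⟶ P) (hk : y ≫ k = 0) : S.E.flip.obj A ⟶ (linearYoneda R C).obj P :=
  have spec {W : C} (ε : Ext S.E W A) := (exists_pull_eq h ε (hx.push_eq_zero ε)).choose_spec
  { app := fun W => ModuleCat.ofHom (Y := W.unop ⟶ P)
      { toFun := fun (ε : Ext S.E W.unop A) =>
          (exists_pull_eq h ε (hx.push_eq_zero ε)).choose ≫ k
        map_add' := fun ε ε' => by
          rw [← Preadditive.add_comp]
          exact comp_eq_of_pull_eq h hk (by rw [S.bilinear.add_pull, spec, spec, spec])
        map_smul' := fun r ε => by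
          rw [RingHom.id_apply, ← Linear.smul_comp]
          exact comp_eq_of_pull_eq h hk (by rw [S.bilinear.smul_pull, spec, spec]) }
    naturality := fun W W' f => by
      refine ModuleCat.hom_ext (LinearMap.ext fun ε => ?_)
      refine Eq.trans ?_ (Category.assoc _ _ _)
      exact comp_eq_of_pull_eq h hk (by rw [pull_comp, spec, spec]; rfl) }

lemma natTrans_eq_zero_iff_of_projective_deflation (h : S.s δ = seqClass x y)
    (hy : S.IsProjectiveMor y) (I : C) :
    (∀ α : S.E.obj (op X) ⟶ (linearCoyoneda R C).obj (op I), α = 0) ↔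
      ∀ k : I ⟶ A, k ≫ x = 0 → k = 0 := by
  constructor
  · intro H k hk
    have h₁ : k ≫ (exists_push_eq h δ (hy.pull_eq_zero δ)).choose = 0 :=
      congr((NatTrans.app $(H (natTransOfProjectiveDeflation h hy k hk)) A).hom δ)
    -- The chosen map and `𝟙 A` both push `δ` to `δ`, so their composites with `k` agree.
    rw [← h₁, comp_eq_of_push_eq h hk (a' := 𝟙 A), Category.comp_id]
    rw [(exists_push_eq h δ (hy.pull_eq_zero δ)).choose_spec, push_id]
  · intro H α
    have nat {Y Y' : C} (f : Y ⟶ Y') (ε : Ext S.E X Y) :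
        (α.app Y').hom (push S.E f ε) = ((α.app Y).hom ε : I ⟶ Y) ≫ f :=
      congr(($(α.naturality f)).hom ε)
    -- Naturality along `x`, together with `x_* δ = 0`, shows that `x` kills this value.
    have h₀ : ((α.app A).hom δ : I ⟶ A) = 0 := by
      refine H _ ((nat x δ).symm.trans ?_)
      rw [ExtriangulatedStructure.push_eq_zero h]
      exact map_zero _
    refine NatTrans.ext (funext fun Y => ModuleCat.hom_ext (LinearMap.ext fun ε => ?_))
    obtain ⟨a, rfl⟩ := exists_push_eq h ε (hy.pull_eq_zero ε)
    refine (nat a δ).trans ?_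
    rw [h₀]
    exact zero_comp

lemma natTrans_eq_zero_iff_of_injective_inflation (h : S.s δ = seqClass x y)
    (hx : S.IsInjectiveMor x) (P : C) :
    (∀ α : S.E.flip.obj A ⟶ (linearYoneda R C).obj P, α = 0) ↔
      ∀ k : X ⟶ P, y ≫ k = 0 → k = 0 := by
  constructor
  · intro H k hk
    have h₁ : (exists_pull_eq h δ (hx.push_eq_zero δ)).choose ≫ k = 0 :=
      congr((NatTrans.app $(H (natTransOfInjectiveInflation h hx k hk)) (op X)).hom δ)
    rw [← h₁, comp_eq_of_pull_eq h hk (c' := 𝟙 X), Category.id_comp]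
    rw [(exists_pull_eq h δ (hx.push_eq_zero δ)).choose_spec, pull_id]
  · intro H α
    have nat {W W' : C} (f : W' ⟶ W) (ε : Ext S.E W A) :
        (α.app (op W')).hom (pull S.E f ε) = f ≫ ((α.app (op W)).hom ε : W ⟶ P) :=
      congr(($(α.naturality f.op)).hom ε)
    have h₀ : ((α.app (op X)).hom δ : X ⟶ P) = 0 := by
      refine H _ ((nat y δ).symm.trans ?_)
      rw [ExtriangulatedStructure.pull_eq_zero h]
      exact map_zero _
    refine NatTrans.ext (funext fun W => ModuleCat.hom_ext (LinearMap.ext fun ε => ?_))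
    obtain ⟨c, hc⟩ := exists_pull_eq (W := W.unop) h ε (hx.push_eq_zero (X := W.unop) ε)
    rw [← hc]
    refine (nat c δ).trans ?_
    rw [h₀]
    exact comp_zero

end

lemma isZero_negExtI_one_iff (hS : S.EnoughProjectiveMors) (I : C) :
    IsZero ((S.negExtI 1).obj (op I)) ↔ ∀ (A B : C) (x : A ⟶ B), S.IsInflation x →
      Function.Injective (fun f : I ⟶ A => f ≫ x) := by
  rw [isZero_negExtI_obj_iff]
  constructor
  · rintro H A B x ⟨X, y, δ, h⟩
    obtain ⟨G, g, ⟨K, κ, δ₀, h₀⟩, hg⟩ := hS X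
    refine (injective_iff_map_eq_zero (Preadditive.rightComp I x)).2 ?_
    exact eq_zero_of_comp_inflation_eq_zero h₀ h (hg.pull_eq_zero δ)
      ((natTrans_eq_zero_iff_of_projective_deflation h₀ hg I).1 (H X))
  · intro H X
    obtain ⟨G, g, ⟨K, κ, δ₀, h₀⟩, hg⟩ := hS X
    exact (natTrans_eq_zero_iff_of_projective_deflation h₀ hg I).2
      ((injective_iff_map_eq_zero (Preadditive.rightComp I κ)).1 (H K G κ ⟨X, g, δ₀, h₀⟩))

lemma isZero_negExtII_one_iff (hS : S.EnoughInjectiveMors) (P : C) :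
    IsZero ((S.negExtII 1).flip.obj P) ↔ ∀ (B D : C) (y : B ⟶ D), S.IsDeflation y →
      Function.Injective (fun f : D ⟶ P => y ≫ f) := by
  rw [isZero_negExtII_flip_obj_iff]
  constructor
  · rintro H B X y ⟨A, x, δ, h⟩
    obtain ⟨G, g, ⟨Q, q, δ₀, h₀⟩, hg⟩ := hS A
    refine (injective_iff_map_eq_zero (Preadditive.leftComp P y)).2 ?_
    exact eq_zero_of_deflation_comp_eq_zero h₀ h (hg.push_eq_zero δ)
      ((natTrans_eq_zero_iff_of_injective_inflation h₀ hg P).1 (H A))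
  · intro H A
    obtain ⟨G, g, ⟨Q, q, δ₀, h₀⟩, hg⟩ := hS A
    exact (natTrans_eq_zero_iff_of_injective_inflation h₀ hg P).2
      ((injective_iff_map_eq_zero (Preadditive.leftComp P q)).1 (H G Q q ⟨A, g, δ₀, h₀⟩))

/-! ### Vanishing on objects versus vanishing on morphisms. -/

lemma IsInjectiveMor.exists_factorization {X X' : C} {i : X ⟶ X'} (hi : S.IsInjectiveMor i)
    (hS : S.EnoughInjectiveObjs) :
    ∃ (I : C) (j : X ⟶ I) (b : I ⟶ X'), S.IsInjectiveObj I ∧ j ≫ b = i := by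
  obtain ⟨I, j, hI, Z, z, δ, h⟩ := hS X
  obtain ⟨b, hb⟩ := exists_desc_of_push_eq_zero h i (hi.push_eq_zero δ)
  exact ⟨I, j, b, hI, hb⟩

lemma IsProjectiveMor.exists_factorization {X X' : C} {p : X ⟶ X'} (hp : S.IsProjectiveMor p)
    (hS : S.EnoughProjectiveObjs) :
    ∃ (P : C) (b : X ⟶ P) (q : P ⟶ X'), S.IsProjectiveObj P ∧ b ≫ q = p := by
  obtain ⟨P, q, hP, Z, z, δ, h⟩ := hS X'
  obtain ⟨b, hb⟩ := exists_lift_of_pull_eq_zero h p (hp.pull_eq_zero δ)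
  exact ⟨P, b, q, hP, hb⟩

/-- An injective morphism factors through an injective object; conversely the identity of an
injective object is an injective inflation. This holds for any functor, so it applies in each degree
separately. -/
lemma forall_injectiveObj_isZero_iff {D : Type*} [Category* D] [HasZeroMorphisms D]
    (hS : S.EnoughInjectiveObjs) (F : Cᵒᵖ ⥤ D) :
    (∀ I : C, S.IsInjectiveObj I → IsZero (F.obj (op I))) ↔
      ∀ (X X' : C) (i : X ⟶ X'), S.IsInflation i → S.IsInjectiveMor i → F.map i.op = 0 := by
  constructor
  · intro H X X' i _ hi
    obtain ⟨I, j, b, hI, rfl⟩ := hi.exists_factorization hS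
    rw [op_comp, F.map_comp, (H I hI).eq_zero_of_tgt (F.map b.op), zero_comp]
  · intro H I hI
    rw [IsZero.iff_id_eq_zero, ← F.map_id]
    exact H I I (𝟙 I) (isInflation_id S I)
      (isInjectiveMor_of_push_eq_zero fun X δ => by rw [hI.ext_eq_zero δ, push_zero])

lemma forall_projectiveObj_isZero_iff {D : Type*} [Category* D] [HasZeroMorphisms D]
    (hS : S.EnoughProjectiveObjs) (F : C ⥤ D) :
    (∀ P : C, S.IsProjectiveObj P → IsZero (F.obj P)) ↔
      ∀ (X X' : C) (p : X ⟶ X'), S.IsDeflation p → S.IsProjectiveMor p → F.map p = 0 := by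
  constructor
  · intro H X X' p _ hp
    obtain ⟨P, b, q, hP, rfl⟩ := hp.exists_factorization hS
    rw [F.map_comp, (H P hP).eq_zero_of_tgt (F.map b), zero_comp]
  · intro H P hP
    rw [IsZero.iff_id_eq_zero, ← F.map_id]
    exact H P P (𝟙 P) (isDeflation_id S P)
      (isProjectiveMor_of_pull_eq_zero fun A δ => by rw [hP.ext_eq_zero δ, pull_zero])

end ExtriangulatedStructure

end

end Extri

theorem mainTheorem11 (R : Type u) [CommRing R] (C : Type u) [SmallCategory C]
    [Preadditive C] [Linear R C] [HasFiniteBiproducts C]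
    (S : Extri.ExtriangulatedStructure R C) :
    (S.EnoughProjectiveMors → S.EnoughInjectiveObjs →
      List.TFAE [
        ∀ I : C, S.IsInjectiveObj I → IsZero ((S.negExtI 1).obj (op I)),
        ∀ I : C, S.IsInjectiveObj I → ∀ n : ℕ, 0 < n → IsZero ((S.negExtI n).obj (op I)),
        ∀ (X X' : C) (i : X ⟶ X'), S.IsInflation i → S.IsInjectiveMor i →
          ∀ n : ℕ, 0 < n → (S.negExtI n).map i.op = 0,
        ∀ I : C, S.IsInjectiveObj I → ∀ (A B : C) (x : A ⟶ B), S.IsInflation x →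
          Function.Injective (fun f : I ⟶ A => f ≫ x)]) ∧
    (S.EnoughInjectiveMors → S.EnoughProjectiveObjs →
      List.TFAE [
        ∀ P : C, S.IsProjectiveObj P → IsZero ((S.negExtII 1).flip.obj P),
        ∀ P : C, S.IsProjectiveObj P → ∀ n : ℕ, 0 < n → IsZero ((S.negExtII n).flip.obj P),
        ∀ (X X' : C) (p : X ⟶ X'), S.IsDeflation p → S.IsProjectiveMor p →
          ∀ n : ℕ, 0 < n → (S.negExtII n).flip.map p = 0,
        ∀ P : C, S.IsProjectiveObj P → ∀ (B D : C) (y : B ⟶ D), S.IsDeflation y →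
          Function.Injective (fun f : D ⟶ P => y ≫ f)]) := by
  refine ⟨fun hP hI => ?_, fun hI hP => ?_⟩
  · tfae_have 1 → 2 := fun h I hI => S.isZero_negExtI_of_one (h I hI)
    tfae_have 2 → 3 := fun h X X' i hi hi' n hn =>
      (S.forall_injectiveObj_isZero_iff hI (S.negExtI n)).1 (fun I hI => h I hI n hn) X X' i hi hi'
    tfae_have 3 → 1 := fun h =>
      (S.forall_injectiveObj_isZero_iff hI (S.negExtI 1)).2
        fun X X' i hi hi' => h X X' i hi hi' 1 one_pos
    tfae_have 1 ↔ 4 := forall₂_congr fun I _ => S.isZero_negExtI_one_iff hP I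
    tfae_finish
  · tfae_have 1 → 2 := fun h P hP => S.isZero_negExtII_of_one (h P hP)
    tfae_have 2 → 3 := fun h X X' p hp hp' n hn =>
      (S.forall_projectiveObj_isZero_iff hP (S.negExtII n).flip).1
        (fun P hP => h P hP n hn) X X' p hp hp'
    tfae_have 3 → 1 := fun h =>
      (S.forall_projectiveObj_isZero_iff hP (S.negExtII 1).flip).2
        fun X X' p hp hp' => h X X' p hp hp' 1 one_pos
    tfae_have 1 ↔ 4 := forall₂_congr fun P _ => S.isZero_negExtII_one_iff hI P
    tfae_finish
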